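/- Let $G$ be a finite simple graph with vertex set $V=\{1,\dots,n\}$. For $i\in V$ let $g_i=X^{(i)}\bigotimes_{j\in\mathcal N(i)}Z^{(j)}$ be the operator on $n$ qubits acting as the Pauli matrix $X$ on qubit $i$, as the Pauli matrix $Z$ on the neighbours of $i$, and as the identity elsewhere; let $S$ be the set of all products of the operators $g_i$, with the identity operator removed (the stabilizing operators of the graph state of $G$). Every $s\in S$ has the form $s=\varepsilon\bigotimes_{k=1}^n O^{(k)}$ with $\varepsilon\in\{1,-1\}$ and $O^{(k)}\in\{I,X,Y,Z\}$. An event of $s$ consists of the operators $O^{(1)},\dots,O^{(n)}$ together with an outcome $m_k\in\{1,-1\}$ for every $k$ with $O^{(k)}\neq I$, such that $\prod_k m_k=\varepsilon$; thus $s$ has $2^{w-1}$ events, where $w$ is the number of $k$ with $O^{(k)}\ne I$. Two events are exclusive if there is a $k$ at which both measure the same operator $O^{(k)}\in\{X,Y,Z\}$ but have different outcomes. Let $H(G)$ be the graph whose vertices are the events of all $s\in S$ and whose edges are the pairs of exclusive events, and let $\alpha$ denote the independence number. **Proposition.** For every $n\ge 1$, the complete graph $K_n$ on $n$ vertices satisfies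 $$\alpha(H(K_n))=\begin{cases}2^{\frac{n-3}{2}}+3\cdot 2^{n-2}-1, & n\text{ odd},\\[2pt] 2^{\frac n2-1}-2^{n-2}+2^n-1, & n\text{ even}.\end{cases}$$ -/

import Mathlib

noncomputable section

namespace GraphState

/-- The three nontrivial single-qubit Pauli measurements. -/
inductive Axis
  | X
  | Y
  | Z

/-- The Pauli matrices. -/
def Axis.matrix : Axis → Matrix (Fin 2) (Fin 2) ℂ
  | .X => !![0, 1; 1, 0]
  | .Y => !![0, -Complex.I; Complex.I, 0]
  | .Z => !![1, 0; 0, -1]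

variable {V : Type*} [Fintype V] [DecidableEq V]

/-- The tensor product `⨂ₖ Mₖ` of one-qubit operators, one for each `k : V`, as a matrix in the
computational basis, which is indexed by `V → Fin 2`. -/
def tensor (M : V → Matrix (Fin 2) (Fin 2) ℂ) : Matrix (V → Fin 2) (V → Fin 2) ℂ :=
  Matrix.of fun a b => ∏ k, M k (a k) (b k)

open Classical in
/-- The generator `gᵢ = X⁽ⁱ⁾ ⨂_{j ∈ N(i)} Z⁽ʲ⁾` belonging to the vertex `i` of `G`. -/
def generator (G : SimpleGraph V) (i : V) : Matrix (V → Fin 2) (V → Fin 2) ℂ :=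
  tensor fun j =>
    if j = i then Axis.X.matrix else if G.Adj i j then Axis.Z.matrix else 1

/-- The stabilizing operators of the graph state of `G`: all products of generators,
the identity operator being removed. -/
def stabilizers (G : SimpleGraph V) : Set (Matrix (V → Fin 2) (V → Fin 2) ℂ) :=
  {s | s ∈ Submonoid.closure (Set.range (generator G)) ∧ s ≠ 1}

/-- A record of single-qubit measurements and their outcomes: at the qubit `k`, `none` (written
`I`) means that nothing is measured, `some (P, m)` means that `P` is measured with result
`m = ±1` (written as the letter `x`, `y`, `z`, underlined when `m = -1`). -/
abbrev Word (V : Type*) : Type _ := V → Option (Axis × ℤˣ)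

/-- The one-qubit operator measured, the identity if nothing is measured. -/
def measured : Option (Axis × ℤˣ) → Matrix (Fin 2) (Fin 2) ℂ
  | none => 1
  | some (P, _) => P.matrix

/-- The outcome at one qubit, counted as `1` if nothing is measured. -/
def outcome : Option (Axis × ℤˣ) → ℤˣ
  | none => 1
  | some (_, m) => m

/-- `e` is an event of the stabilizing operator `s` if `s = ε ⨂ₖ O⁽ᵏ⁾`, where `O⁽ᵏ⁾` is the
operator measured by `e` at `k` and where the sign `ε` is the product of the outcomes of `e`.
So an `s` of weight `w` has `2 ^ (w - 1)` events. -/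
def IsEventOf (e : Word V) (s : Matrix (V → Fin 2) (V → Fin 2) ℂ) : Prop :=
  s = (((∏ k, outcome (e k) : ℤˣ) : ℤ) : ℂ) • tensor fun k => measured (e k)

/-- The events of all the stabilizing operators. -/
def events (G : SimpleGraph V) : Set (Word V) :=
  {e | ∃ s ∈ stabilizers G, IsEventOf e s}

/-- Two events are exclusive if at some qubit the same measurement gives different outcomes. -/
def Exclusive (e f : Word V) : Prop :=
  ∃ (k : V) (P : Axis) (a b : ℤˣ), e k = some (P, a) ∧ f k = some (P, b) ∧ a ≠ b

/-- The graph `H(G)`: its vertices are the events, its edges the pairs of exclusive events. -/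
def exclusivityGraph (G : SimpleGraph V) : SimpleGraph (events G) where
  Adj e f := Exclusive e.1 f.1
  symm := ⟨by
    rintro e f ⟨k, P, a, b, he, hf, hab⟩
    exact ⟨k, P, b, a, hf, he, hab.symm⟩⟩
  loopless := ⟨by
    rintro e ⟨k, P, a, b, he, hf, hab⟩
    rw [he] at hf
    simp_all⟩

end GraphState

end

/-! For `K_n` the stabilizing operators are indexed by nonempty sets `A` (`mem_events_top`): if `#A`
is even, `Y` on `A` with sign `+1`; if odd, `X` on `A`, `Z` off `A`, with sign `(-1) ^ (#A / 2)`.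
Pairwise non-exclusive events extend to one noncontextual assignment `m`, and each `m` yields an
independent set, so the independence number is the largest number of stabilizing operators that an
`m` satisfies.

Even and odd sets involve disjoint letters. Setting all `Y` to `1` satisfies every even set. The odd
sets form a Mermin inequality: satisfied minus violated is the imaginary part of `∏ (z_k + i x_k)`
(`merminProduct_im`). Hence `4α = 3 * 2 ^ n - 4 + 2 * max Im`. The product has modulus `2 ^ (n /
2)`, which is attained as `Im` for even `n`. For odd `n` its square is purely imaginary, which costs
a factor `√2`. -/

namespace GraphState

open Finset

/-! ### One-qubit Pauli algebra -/

section Pauli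

/-- The Pauli matrix of a letter, the identity for `none`. -/
def pauli : Option Axis → Matrix (Fin 2) (Fin 2) ℂ
  | none => 1
  | some P => P.matrix

lemma measured_eq_pauli (o : Option (Axis × ℤˣ)) : measured o = pauli (o.map Prod.fst) := by
  rcases o with _ | ⟨P, m⟩ <;> rfl

lemma trace_pauli_mul_pauli_of_ne {o p : Option Axis} (h : o ≠ p) :
    (pauli o * pauli p).trace = 0 := by
  rcases o with _ | _ | _ | _ <;> rcases p with _ | _ | _ | _ <;>
    simp_all [pauli, Axis.matrix, Matrix.trace_fin_two]

lemma pauli_mul_self (o : Option Axis) : pauli o * pauli o = 1 := by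
  rcases o with _ | _ | _ | _ <;>
    simp [pauli, Axis.matrix, Matrix.one_fin_two]

lemma matrix_Z_mul_Y : Axis.Z.matrix * Axis.Y.matrix = (-Complex.I) • Axis.X.matrix := by
  simp [Axis.matrix]

lemma matrix_Z_mul_X : Axis.Z.matrix * Axis.X.matrix = Complex.I • Axis.Y.matrix := by
  simp [Axis.matrix]

lemma matrix_X_mul_Z : Axis.X.matrix * Axis.Z.matrix = (-Complex.I) • Axis.Y.matrix := by
  simp [Axis.matrix]

lemma matrix_mul_self (P : Axis) : P.matrix * P.matrix = 1 := pauli_mul_self (some P)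

end Pauli

variable {V : Type*} [Fintype V] [DecidableEq V]

/-! ### Tensor products and the trace form -/

section Tensor

lemma tensor_mul (M N : V → Matrix (Fin 2) (Fin 2) ℂ) :
    tensor M * tensor N = tensor fun k => M k * N k := by
  ext a b
  simp only [tensor, Matrix.mul_apply, Matrix.of_apply, Finset.prod_univ_sum,
    Fintype.piFinset_univ, Finset.prod_mul_distrib]

omit [DecidableEq V] in
lemma tensor_smul (c : V → ℂ) (M : V → Matrix (Fin 2) (Fin 2) ℂ) :
    (tensor fun k => c k • M k) = (∏ k, c k) • tensor M := by
  ext a b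
  simp [tensor, Finset.prod_mul_distrib]

omit [DecidableEq V] in
lemma tensor_one : (tensor fun _ : V => (1 : Matrix (Fin 2) (Fin 2) ℂ)) = 1 := by
  ext a b
  simp only [tensor, Matrix.of_apply, Matrix.one_apply, Finset.prod_ite_zero, funext_iff]
  simp

lemma trace_tensor (M : V → Matrix (Fin 2) (Fin 2) ℂ) :
    (tensor M).trace = ∏ k, (M k).trace := by
  simp only [Matrix.trace, Matrix.diag_apply, tensor, Matrix.of_apply, Finset.prod_univ_sum,
    Fintype.piFinset_univ]

/-- A signed Pauli word determines its letters and its sign. -/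
lemma smul_tensor_pauli_injective {δ ε : ℤˣ} {o p : V → Option Axis}
    (h : (((δ : ℤ) : ℂ) • tensor fun k => pauli (o k)) =
      ((ε : ℤ) : ℂ) • tensor fun k => pauli (p k)) : o = p ∧ δ = ε := by
  have hunit : ∀ u : ℤˣ, ((u : ℤ) : ℂ) ≠ 0 := fun u => by
    exact_mod_cast u.ne_zero
  -- Distinct Pauli words are orthogonal for the trace form: one differing letter would make the
  -- left side vanish, but the right side is nonzero.
  have htr := congrArg (fun T => (T * tensor fun k => pauli (p k)).trace) h
  simp only [Matrix.smul_mul, tensor_mul, Matrix.trace_smul, trace_tensor, pauli_mul_self,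
    smul_eq_mul, Matrix.trace_one, Fintype.card_fin, Finset.prod_const, Nat.cast_ofNat] at htr
  have hop : o = p := by
    funext k
    by_contra hk
    rw [Finset.prod_eq_zero (mem_univ k) (trace_pauli_mul_pauli_of_ne hk), mul_zero] at htr
    exact mul_ne_zero (hunit ε) (pow_ne_zero _ two_ne_zero) htr.symm
  subst hop
  simp only [pauli_mul_self, Matrix.trace_one, Fintype.card_fin, Finset.prod_const,
    Nat.cast_ofNat] at htr
  refine ⟨rfl, Units.ext ?_⟩
  exact_mod_cast mul_right_cancel₀ (pow_ne_zero _ two_ne_zero) htr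

end Tensor

/-! ### Stabilizing operators of the complete graph -/

section Complete

/-- The letters of the product of the generators of the complete graph over `A`. -/
def letter (A : Finset V) (k : V) : Option Axis :=
  if Odd #A then (if k ∈ A then some .X else some .Z) else (if k ∈ A then some .Y else none)

/-- The sign of the product of the generators of the complete graph over `A`. -/
def stabilizerSign (A : Finset V) : ℤˣ :=
  if Odd #A then (-1) ^ (#A / 2) else 1

/-- The product of the generators of the complete graph over `A`. -/
noncomputable def completeStabilizer (A : Finset V) : Matrix (V → Fin 2) (V → Fin 2) ℂ :=
  ((stabilizerSign A : ℤ) : ℂ) • tensor fun k => pauli (letter A k)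

omit [Fintype V] in
lemma mem_iff_letter (A : Finset V) (k : V) :
    k ∈ A ↔ letter A k = some .X ∨ letter A k = some .Y := by
  unfold letter
  split_ifs <;> simp_all

omit [Fintype V] in
lemma letter_injective : Function.Injective (letter : Finset V → V → Option Axis) := by
  intro A B h
  ext k
  rw [mem_iff_letter, mem_iff_letter, h]

omit [Fintype V] in
lemma letter_empty : letter (∅ : Finset V) = fun _ => none := by
  funext k
  simp [letter]

lemma generator_top (i : V) :
    generator (⊤ : SimpleGraph V) i =
      tensor fun j => if j = i then Axis.X.matrix else Axis.Z.matrix := by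
  unfold generator
  congr 1
  funext j
  by_cases h : j = i
  · simp [h]
  · simp [h, Ne.symm h]

lemma generator_top_mul_self (i : V) :
    generator (⊤ : SimpleGraph V) i * generator ⊤ i = 1 := by
  rw [generator_top, tensor_mul, ← tensor_one]
  congr 1
  funext j
  split_ifs <;> exact matrix_mul_self _

lemma completeStabilizer_empty : completeStabilizer (∅ : Finset V) = 1 := by
  simp [completeStabilizer, letter_empty, stabilizerSign, pauli, tensor_one]

/-- Each site of `A` contributes `ZY = -iX`; for `#A = 2m` the phases multiply to `(-1) ^ m`, the
sign of the enlarged set. -/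
lemma generator_mul_completeStabilizer_of_even {i : V} {A : Finset V} (hi : i ∉ A)
    (hA : Even #A) :
    generator ⊤ i * completeStabilizer A = completeStabilizer (insert i A) := by
  have hodd : ¬ Odd #A := Nat.not_odd_iff_even.mpr hA
  have hodd' : Odd #(insert i A) := by
    rw [card_insert_of_notMem hi]; exact hA.add_one
  have hk : ∀ k, ((if k = i then Axis.X.matrix else Axis.Z.matrix) * pauli (letter A k)) =
      (if k ∈ A then -Complex.I else 1) • pauli (letter (insert i A) k) := by
    intro k
    simp only [letter, hodd, hodd', if_true, if_false, mem_insert]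
    by_cases h : k = i
    · subst h; simp [hi, pauli]
    · by_cases h' : k ∈ A <;> simp [h, h', pauli, matrix_Z_mul_Y]
  rw [generator_top, completeStabilizer, completeStabilizer, Matrix.mul_smul, tensor_mul]
  simp only [hk]
  rw [tensor_smul, smul_smul]
  congr 1
  simp only [prod_ite_mem, univ_inter, prod_const, stabilizerSign, hodd, hodd', if_true, if_false]
  obtain ⟨m, hm⟩ := hA
  rw [card_insert_of_notMem hi, hm, show (m + m + 1) / 2 = m by lia, ← two_mul, pow_mul]
  simp

/-- The site `i` contributes `XZ = -iY` and each site of `A` contributes `ZX = iY`; for `#A = 2m +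
1` the total phase `(-1) ^ m` cancels the sign of `A`. -/
lemma generator_mul_completeStabilizer_of_odd {i : V} {A : Finset V} (hi : i ∉ A)
    (hA : Odd #A) :
    generator ⊤ i * completeStabilizer A = completeStabilizer (insert i A) := by
  have hodd' : ¬ Odd #(insert i A) := by
    rw [card_insert_of_notMem hi, Nat.not_odd_iff_even]; exact hA.add_one
  have hk : ∀ k, ((if k = i then Axis.X.matrix else Axis.Z.matrix) * pauli (letter A k)) =
      ((if k = i then -Complex.I else 1) * (if k ∈ A then Complex.I else 1)) •
        pauli (letter (insert i A) k) := by
    intro k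
    simp only [letter, hA, hodd', if_true, if_false, mem_insert]
    by_cases h : k = i
    · subst h; simp [hi, pauli, matrix_X_mul_Z]
    · by_cases h' : k ∈ A <;> simp [h, h', pauli, matrix_Z_mul_X, matrix_mul_self]
  rw [generator_top, completeStabilizer, completeStabilizer, Matrix.mul_smul, tensor_mul]
  simp only [hk]
  rw [tensor_smul, smul_smul]
  congr 1
  simp only [prod_mul_distrib, prod_ite_eq', mem_univ, prod_ite_mem, univ_inter, prod_const,
    stabilizerSign, hA, hodd', if_true, if_false]
  obtain ⟨m, hm⟩ := hA
  rw [hm, show (2 * m + 1) / 2 = m by lia, pow_succ, pow_mul]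
  push_cast
  rw [Complex.I_sq]
  calc ((-1 : ℂ) ^ m * (-Complex.I * ((-1) ^ m * Complex.I)))
      = ((-1) ^ m * (-1) ^ m) * -(Complex.I * Complex.I) := by ring
    _ = 1 := by rw [← mul_pow, Complex.I_mul_I]; simp

lemma generator_mul_completeStabilizer {i : V} {A : Finset V} (hi : i ∉ A) :
    generator ⊤ i * completeStabilizer A = completeStabilizer (insert i A) := by
  rcases Nat.even_or_odd #A with h | h
  · exact generator_mul_completeStabilizer_of_even hi h
  · exact generator_mul_completeStabilizer_of_odd hi h

lemma mem_closure_generator_top {s : Matrix (V → Fin 2) (V → Fin 2) ℂ} :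
    s ∈ Submonoid.closure (Set.range (generator (⊤ : SimpleGraph V))) ↔
      ∃ A, s = completeStabilizer A := by
  constructor
  · intro hs
    induction hs using Submonoid.closure_induction_left with
    | one => exact ⟨∅, completeStabilizer_empty.symm⟩
    | mul_left x hx y hy ih =>
      obtain ⟨i, rfl⟩ := hx
      obtain ⟨A, rfl⟩ := ih
      -- Generators are involutions, so multiplying by one whose index lies in `A` removes that
      -- index.
      by_cases hi : i ∈ A
      · refine ⟨A.erase i, ?_⟩
        conv_lhs => rw [← insert_erase hi]
        rw [← generator_mul_completeStabilizer (notMem_erase i A), ← mul_assoc,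
          generator_top_mul_self, one_mul]
      · exact ⟨_, generator_mul_completeStabilizer hi⟩
  · rintro ⟨A, rfl⟩
    induction A using Finset.induction_on with
    | empty => rw [completeStabilizer_empty]; exact Submonoid.one_mem _
    | insert i A hi ih =>
      rw [← generator_mul_completeStabilizer hi]
      exact Submonoid.mul_mem _ (Submonoid.subset_closure ⟨i, rfl⟩) ih

lemma completeStabilizer_injective :
    Function.Injective (completeStabilizer : Finset V → Matrix (V → Fin 2) (V → Fin 2) ℂ) :=
  fun _ _ h => letter_injective (smul_tensor_pauli_injective h).1

/-- The events of the complete graph. -/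
lemma mem_events_top {e : Word V} :
    e ∈ events (⊤ : SimpleGraph V) ↔
      ∃ A : Finset V, A.Nonempty ∧ (∀ k, (e k).map Prod.fst = letter A k) ∧
        ∏ k, outcome (e k) = stabilizerSign A := by
  simp only [events, stabilizers, IsEventOf, Set.mem_ofPred_eq, mem_closure_generator_top,
    measured_eq_pauli]
  constructor
  · rintro ⟨_, ⟨⟨A, rfl⟩, hA⟩, h⟩
    obtain ⟨h₁, h₂⟩ := smul_tensor_pauli_injective h
    refine ⟨A, nonempty_iff_ne_empty.mpr ?_, fun k => (congrFun h₁ k).symm, h₂.symm⟩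
    rintro rfl
    exact hA completeStabilizer_empty
  · rintro ⟨A, hA, h₁, h₂⟩
    refine ⟨_, ⟨⟨A, rfl⟩, ?_⟩, ?_⟩
    · rw [← completeStabilizer_empty]
      exact completeStabilizer_injective.ne hA.ne_empty
    · simp only [h₁, h₂, completeStabilizer]

end Complete

/-! ### From independent sets to assignments of outcomes -/

section Reduction

instance : Finite Axis :=
  Finite.of_injective (fun P : Axis => match P with | .X => (0 : Fin 3) | .Y => 1 | .Z => 2) (by
    rintro (_ | _ | _) (_ | _ | _) h <;> simp_all)

/-- The event of the stabilizing operator of `A` with the outcomes assigned by `m`, regardless of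
the sign. -/
def word (m : Axis → V → ℤˣ) (A : Finset V) : Word V :=
  fun k => (letter A k).map fun P => (P, m P k)

/-- The sets whose stabilizing operator has the value `1` under the assignment `m`. -/
def consistentSets (m : Axis → V → ℤˣ) : Finset (Finset V) :=
  {A | A.Nonempty ∧ ∏ k, outcome (word m A k) = stabilizerSign A}

omit [Fintype V] in
lemma map_fst_word (m : Axis → V → ℤˣ) (A : Finset V) (k : V) :
    (word m A k).map Prod.fst = letter A k := by
  unfold word
  cases letter A k <;> rfl

omit [Fintype V] in
lemma word_injective (m : Axis → V → ℤˣ) : Function.Injective (word m) := by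
  intro A B h
  refine letter_injective (funext fun k => ?_)
  rw [← map_fst_word m, ← map_fst_word m, h]

lemma word_mem_events {m : Axis → V → ℤˣ} {A : Finset V} (hA : A ∈ consistentSets m) :
    word m A ∈ events (⊤ : SimpleGraph V) := by
  rw [consistentSets, mem_filter] at hA
  exact mem_events_top.mpr ⟨A, hA.2.1, map_fst_word m A, hA.2.2⟩

omit [Fintype V] in
lemma word_eq_some {m : Axis → V → ℤˣ} {A : Finset V} {k : V} {P : Axis} {a : ℤˣ}
    (h : word m A k = some (P, a)) : a = m P k := by
  unfold word at h
  cases hl : letter A k with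
  | none => simp [hl] at h
  | some Q =>
    rw [hl, Option.map_some, Option.some_inj, Prod.mk.injEq] at h
    rw [← h.1, h.2]

/-- Events read off from one assignment never disagree on a common measurement. -/
lemma card_consistentSets_le_indepNum (m : Axis → V → ℤˣ) :
    #(consistentSets m) ≤ (exclusivityGraph (⊤ : SimpleGraph V)).indepNum := by
  let f : consistentSets m ↪ events (⊤ : SimpleGraph V) :=
    ⟨fun A => ⟨word m A.1, word_mem_events A.2⟩, fun A B h =>
      Subtype.ext (word_injective m (congrArg Subtype.val h))⟩
  have hind : (exclusivityGraph (⊤ : SimpleGraph V)).IsIndepSet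
      ((univ.map f : Finset (events (⊤ : SimpleGraph V))) : Set (events (⊤ : SimpleGraph V))) := by
    intro e he e' he' _
    simp only [coe_map, coe_univ, Set.image_univ, Set.mem_range] at he he'
    obtain ⟨A, rfl⟩ := he
    obtain ⟨B, rfl⟩ := he'
    rintro ⟨k, P, a, b, ha, hb, hab⟩
    exact hab ((word_eq_some ha).trans (word_eq_some hb).symm)
  simpa using hind.card_le_indepNum

/-- Pairwise non-exclusive events come from a common assignment of outcomes. -/
lemma exists_indepNum_le_card_consistentSets :
    ∃ m : Axis → V → ℤˣ,
      (exclusivityGraph (⊤ : SimpleGraph V)).indepNum ≤ #(consistentSets m) := by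
  classical
  obtain ⟨s, hs⟩ := (exclusivityGraph (⊤ : SimpleGraph V)).exists_isNIndepSet_indepNum
  have hagree : ∀ e ∈ s, ∀ e' ∈ s, ∀ k P a b, e.1 k = some (P, a) → e'.1 k = some (P, b) →
      a = b := by
    intro e he e' he' k P a b ha hb
    by_cases hee : e = e'
    · subst hee; simp_all
    · by_contra hab
      exact hs.isIndepSet he he' hee ⟨k, P, a, b, ha, hb, hab⟩
  -- The default `1` is harmless: it is used only where no event of `s` measures `P` at `k`.
  let m : Axis → V → ℤˣ := fun P k =>
    if h : ∃ a, ∃ e ∈ s, e.1 k = some (P, a) then h.choose else 1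
  have hm : ∀ e ∈ s, ∀ k P a, e.1 k = some (P, a) → a = m P k := by
    intro e he k P a ha
    have h : ∃ a, ∃ e ∈ s, e.1 k = some (P, a) := ⟨a, e, he, ha⟩
    obtain ⟨e', he', ha'⟩ := h.choose_spec
    simp only [m, dif_pos h]
    exact hagree e he e' he' k P _ _ ha ha'
  have hA : ∀ e : events (⊤ : SimpleGraph V), ∃ A : Finset V, e ∈ s →
      A ∈ consistentSets m ∧ e.1 = word m A := by
    intro e
    obtain ⟨A, hA, h₁, h₂⟩ := mem_events_top.mp e.2
    refine ⟨A, fun he => ?_⟩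
    have hword : e.1 = word m A := by
      funext k
      have h := h₁ k
      unfold word
      rw [← h]
      cases hk : e.1 k with
      | none => rfl
      | some p =>
        obtain ⟨P, a⟩ := p
        simp [hm e he k P a hk]
    refine ⟨?_, hword⟩
    rw [consistentSets, mem_filter, ← hword]
    exact ⟨mem_univ _, hA, h₂⟩
  choose A hA using hA
  refine ⟨m, hs.card_eq ▸ card_le_card_of_injOn A (fun e he => (hA e he).1) ?_⟩
  intro e he e' he' h
  apply Subtype.ext
  rw [(hA e he).2, (hA e' he').2, h]

end Reduction

/-! ### Counting satisfied sets by parity -/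

section Counting

omit [DecidableEq V] in
lemma two_mul_card_odd_sets [Nonempty V] :
    2 * #{A : Finset V | Odd #A} = 2 ^ Fintype.card V := by
  have h := sum_powerset_neg_one_pow_card_of_nonempty (univ_nonempty (α := V))
  rw [powerset_univ] at h
  have h' : ∀ A : Finset V, (if Odd #A then (2 : ℤ) else 0) = 1 - (-1) ^ #A := by
    intro A
    split_ifs with hA
    · rw [hA.neg_one_pow]; norm_num
    · rw [(Nat.not_odd_iff_even.mp hA).neg_one_pow]; norm_num
  have h2 : (∑ A : Finset V, if Odd #A then (2 : ℤ) else 0) = 2 ^ Fintype.card V := by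
    simp only [h', sum_sub_distrib, h]
    simp
  rw [← sum_filter, sum_const, nsmul_eq_mul, mul_comm] at h2
  exact_mod_cast h2

lemma two_mul_card_nonempty_even_sets_add_one [Nonempty V] :
    2 * (#{A : Finset V | A.Nonempty ∧ ¬ Odd #A} + 1) = 2 ^ Fintype.card V := by
  have h := two_mul_card_odd_sets (V := V)
  have h2 := card_filter_add_card_filter_not (s := (univ : Finset (Finset V))) (fun A => Odd #A)
  have h3 : ({A : Finset V | ¬ Odd #A} : Finset (Finset V)) =
      insert ∅ ({A : Finset V | A.Nonempty ∧ ¬ Odd #A} : Finset (Finset V)) := by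
    ext A
    rcases A.eq_empty_or_nonempty with rfl | hA
    · simp
    · simp [hA, hA.ne_empty]
  rw [h3, card_insert_of_notMem (by simp), card_univ, Fintype.card_finset] at h2
  lia

/-- The Mermin product: the imaginary part of its expansion runs over the odd sets. -/
def merminProduct (m : Axis → V → ℤˣ) : ℂ :=
  ∏ k, (((m .X k : ℤ) : ℂ) * Complex.I + ((m .Z k : ℤ) : ℂ))

lemma prod_outcome_word_of_odd (m : Axis → V → ℤˣ) {A : Finset V} (hA : Odd #A) :
    ∏ k, outcome (word m A k) = (∏ k ∈ A, m .X k) * ∏ k ∈ univ \ A, m .Z k := by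
  rw [← prod_mul_prod_compl A, compl_eq_univ_sdiff]
  congr 1
  · refine prod_congr rfl fun k hk => ?_
    simp [word, letter, hA, hk, outcome]
  · refine prod_congr rfl fun k hk => ?_
    rw [mem_sdiff] at hk
    simp [word, letter, hA, hk.2, outcome]

lemma I_pow_im (j : ℕ) :
    (Complex.I ^ j).im = if Odd j then (-1 : ℝ) ^ (j / 2) else 0 := by
  obtain ⟨i, rfl | rfl⟩ := Nat.even_or_odd' j
  · have : (Complex.I ^ (2 * i)) = (((-1 : ℝ) ^ i : ℝ) : ℂ) := by
      rw [pow_mul, Complex.I_sq]; push_cast; rfl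
    rw [this, Complex.ofReal_im, if_neg (by simp)]
  · have : (Complex.I ^ (2 * i + 1)) = (((-1 : ℝ) ^ i : ℝ) : ℂ) * Complex.I := by
      rw [pow_succ, pow_mul, Complex.I_sq]; push_cast; rfl
    rw [this, Complex.im_ofReal_mul, if_pos (by simp), show (2 * i + 1) / 2 = i by lia]
    simp

/-- In the expansion `A` contributes a sign times `I ^ #A`, whose imaginary part is `0` for even
`#A` and exactly `stabilizerSign A` for odd `#A`. -/
lemma merminProduct_im (m : Axis → V → ℤˣ) :
    (merminProduct m).im = ((∑ A : Finset V with Odd #A,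
      (stabilizerSign A : ℤ) * (∏ k, outcome (word m A k) : ℤˣ) : ℤ) : ℝ) := by
  rw [merminProduct, prod_add, powerset_univ, Complex.im_sum, sum_filter, Int.cast_sum]
  refine sum_congr rfl fun A _ => ?_
  have h : (∏ k ∈ A, ((m .X k : ℤ) : ℂ) * Complex.I) * ∏ k ∈ univ \ A, ((m .Z k : ℤ) : ℂ) =
      ((((∏ k ∈ A, m .X k) * ∏ k ∈ univ \ A, m .Z k : ℤˣ) : ℤ) : ℝ) * Complex.I ^ #A := by
    rw [prod_mul_distrib, prod_const]
    push_cast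
    ring
  rw [h, Complex.im_ofReal_mul, I_pow_im]
  split_ifs with hA
  · rw [prod_outcome_word_of_odd m hA, stabilizerSign, if_pos hA]
    push_cast
    ring
  · simp

lemma four_mul_card_odd_consistentSets [Nonempty V] (m : Axis → V → ℤˣ) :
    (4 * #{A ∈ consistentSets m | Odd #A} : ℝ) =
      2 ^ Fintype.card V + 2 * (merminProduct m).im := by
  have hset : ({A ∈ consistentSets m | Odd #A} : Finset (Finset V)) =
      {A ∈ ({A : Finset V | Odd #A} : Finset (Finset V)) |
        ∏ k, outcome (word m A k) = stabilizerSign A} := by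
    ext A
    simp only [consistentSets, mem_filter, mem_univ, true_and]
    constructor
    · rintro ⟨⟨_, h⟩, h'⟩; exact ⟨h', h⟩
    · rintro ⟨h', h⟩; exact ⟨⟨card_pos.mp h'.pos, h⟩, h'⟩
  -- Each summand is `+1` on a satisfied set and `-1` on a violated one, so `Im` is twice the number
  -- satisfied minus the number of odd sets.
  have hunits : ∀ u v : ℤˣ, (u : ℤ) * v = 2 * (if v = u then 1 else 0) - 1 := by decide
  have hodd := two_mul_card_odd_sets (V := V)
  have hodd' : (2 * #{A : Finset V | Odd #A} : ℝ) = 2 ^ Fintype.card V := by exact_mod_cast hodd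
  rw [merminProduct_im, hset]
  simp only [hunits, sum_sub_distrib, ← mul_sum, sum_boole, sum_const, nsmul_eq_mul, mul_one]
  push_cast
  linarith

lemma four_mul_card_consistentSets_le [Nonempty V] (m : Axis → V → ℤˣ) :
    (4 * #(consistentSets m) : ℝ) ≤
      3 * 2 ^ Fintype.card V - 4 + 2 * (merminProduct m).im := by
  have h := card_filter_add_card_filter_not (s := consistentSets m) (fun A => Odd #A)
  have hle : #{A ∈ consistentSets m | ¬ Odd #A} ≤ #{A : Finset V | A.Nonempty ∧ ¬ Odd #A} := by
    refine card_le_card fun A => ?_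
    simp only [consistentSets, mem_filter, mem_univ, true_and]
    tauto
  have heven : (2 * (#{A : Finset V | A.Nonempty ∧ ¬ Odd #A} + 1) : ℝ) = 2 ^ Fintype.card V := by
    exact_mod_cast two_mul_card_nonempty_even_sets_add_one (V := V)
  have hodd := four_mul_card_odd_consistentSets m
  have hle' : (#{A ∈ consistentSets m | ¬ Odd #A} : ℝ) ≤
    #{A : Finset V | A.Nonempty ∧ ¬ Odd #A} := by exact_mod_cast hle
  have h' : (#{A ∈ consistentSets m | Odd #A} : ℝ) + #{A ∈ consistentSets m | ¬ Odd #A} =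
    #(consistentSets m) := by exact_mod_cast h
  linarith

lemma four_mul_card_consistentSets_eq [Nonempty V] {m : Axis → V → ℤˣ} (hm : ∀ k, m .Y k = 1) :
    (4 * #(consistentSets m) : ℝ) =
      3 * 2 ^ Fintype.card V - 4 + 2 * (merminProduct m).im := by
  have h := card_filter_add_card_filter_not (s := consistentSets m) (fun A => Odd #A)
  have hset : ({A ∈ consistentSets m | ¬ Odd #A} : Finset (Finset V)) =
      ({A : Finset V | A.Nonempty ∧ ¬ Odd #A} : Finset (Finset V)) := by
    ext A
    simp only [consistentSets, mem_filter, mem_univ, true_and]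
    refine ⟨fun h => ⟨h.1.1, h.2⟩, fun h => ⟨⟨h.1, ?_⟩, h.2⟩⟩
    rw [stabilizerSign, if_neg h.2]
    refine prod_eq_one fun k _ => ?_
    by_cases hk : k ∈ A <;> simp [word, letter, h.2, hk, outcome, hm]
  rw [hset] at h
  have heven : (2 * (#{A : Finset V | A.Nonempty ∧ ¬ Odd #A} + 1) : ℝ) = 2 ^ Fintype.card V := by
    exact_mod_cast two_mul_card_nonempty_even_sets_add_one (V := V)
  have hodd := four_mul_card_odd_consistentSets m
  have h' : (#{A ∈ consistentSets m | Odd #A} : ℝ) + #{A : Finset V | A.Nonempty ∧ ¬ Odd #A} =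
    #(consistentSets m) := by exact_mod_cast h
  linarith

end Counting

/-! ### Extremal values of the Mermin product -/

section Mermin

omit [DecidableEq V] in
lemma normSq_merminProduct (m : Axis → V → ℤˣ) :
    Complex.normSq (merminProduct m) = 2 ^ Fintype.card V := by
  have h : ∀ u v : ℤˣ, Complex.normSq (((u : ℤ) : ℂ) * Complex.I + ((v : ℤ) : ℂ)) = 2 := by
    intro u v
    rcases Int.units_eq_one_or u with rfl | rfl <;> rcases Int.units_eq_one_or v with rfl | rfl <;>
      norm_num [Complex.normSq_apply]
  rw [merminProduct, map_prod]
  simp only [h, prod_const, card_univ]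

-- The imaginary part is at most the modulus.
omit [DecidableEq V] in
lemma merminProduct_im_le_of_even (m : Axis → V → ℤˣ) {j : ℕ} (h : Fintype.card V = 2 * j) :
    (merminProduct m).im ≤ 2 ^ j := by
  have hn := normSq_merminProduct m
  rw [Complex.normSq_apply, h, pow_mul'] at hn
  exact le_of_sq_le_sq (by nlinarith [mul_self_nonneg (merminProduct m).re]) (by positivity)

-- Every factor squares to `±2i`, so an odd number of them has a purely imaginary square. Thus `Re²
-- = Im²`, and the squared modulus `2 ^ (2j + 1)` forces `Im² = 2 ^ (2j)`.
omit [DecidableEq V] in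
lemma merminProduct_im_le_of_odd (m : Axis → V → ℤˣ) {j : ℕ} (h : Fintype.card V = 2 * j + 1) :
    (merminProduct m).im ≤ 2 ^ j := by
  have hsq : merminProduct m ^ 2 =
      (((2 ^ Fintype.card V * (-1) ^ j * (∏ k, (m .X k * m .Z k) : ℤˣ) : ℤ)) : ℝ) *
        Complex.I := by
    have hf : ∀ u v : ℤˣ, (((u : ℤ) : ℂ) * Complex.I + ((v : ℤ) : ℂ)) ^ 2 =
        (2 * Complex.I) * (((u * v : ℤˣ) : ℤ) : ℂ) := by
      intro u v
      have hu : ((u : ℤ) : ℂ) ^ 2 = 1 := by exact_mod_cast Int.isUnit_sq u.isUnit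
      have hv : ((v : ℤ) : ℂ) ^ 2 = 1 := by exact_mod_cast Int.isUnit_sq v.isUnit
      push_cast
      linear_combination Complex.I ^ 2 * hu + hv + Complex.I_sq
    rw [merminProduct, ← prod_pow]
    simp only [hf, prod_mul_distrib, prod_const, card_univ]
    rw [h, pow_succ Complex.I, pow_mul Complex.I, Complex.I_sq]
    push_cast
    rw [prod_mul_distrib]
    ring
  have hre : (merminProduct m ^ 2).re = 0 := by rw [hsq, Complex.re_ofReal_mul]; simp
  rw [pow_two, Complex.mul_re] at hre
  have hn := normSq_merminProduct m
  rw [Complex.normSq_apply, h, pow_succ, pow_mul'] at hn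
  exact le_of_sq_le_sq (by nlinarith) (by positivity)

lemma exists_units_eq_neg_I_pow_mul (j : ℕ) :
    ∃ u v : ℤˣ, ((u : ℤ) : ℂ) * Complex.I + ((v : ℤ) : ℂ) =
      (-Complex.I) ^ j * (Complex.I + 1) := by
  induction j with
  | zero => exact ⟨1, 1, by simp⟩
  | succ j ih =>
    obtain ⟨u, v, h⟩ := ih
    -- Multiplication by `-i` permutes the four numbers `±i ± 1`: `-i(ui + v) = -vi + u`.
    refine ⟨-v, u, ?_⟩
    rw [pow_succ', mul_assoc, ← h]
    push_cast
    linear_combination ((u : ℤ) : ℂ) * Complex.I_sq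

/-- All factors of the Mermin product but one may be taken equal to `1 + i`, and the remaining
one to be `1 + i` times any power of `-i`. -/
lemma exists_merminProduct_eq (i j : ℕ) :
    ∃ m : Axis → Fin (j + 1) → ℤˣ, (∀ k, m .Y k = 1) ∧
      merminProduct m = (-Complex.I) ^ i * (Complex.I + 1) ^ (j + 1) := by
  obtain ⟨u, v, h⟩ := exists_units_eq_neg_I_pow_mul i
  refine ⟨fun P => match P with
    | .X => Fin.cons u fun _ => 1
    | .Y => fun _ => 1
    | .Z => Fin.cons v fun _ => 1, fun _ => rfl, ?_⟩
  rw [merminProduct, Fin.prod_univ_succ]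
  simp only [Fin.cons_zero, Fin.cons_succ, h]
  simp
  ring

/-- Since `(1 + i)² = 2i`, each `-i` rotates one pair of factors to the real number `2`. The
leftover factor is `1 + i` for an odd number of qubits and `(1 + i)² = 2i` for an even one. -/
lemma neg_I_pow_mul (j : ℕ) :
    (-Complex.I) ^ j * (Complex.I + 1) ^ (2 * j) = ((2 ^ j : ℝ) : ℂ) := by
  rw [pow_mul, ← mul_pow]
  push_cast
  congr 1
  linear_combination (-Complex.I - 2) * Complex.I_sq

lemma exists_merminProduct_im_of_odd (j : ℕ) :
    ∃ m : Axis → Fin (2 * j + 1) → ℤˣ, (∀ k, m .Y k = 1) ∧ (merminProduct m).im = 2 ^ j := by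
  obtain ⟨m, hY, hm⟩ := exists_merminProduct_eq j (2 * j)
  refine ⟨m, hY, ?_⟩
  rw [hm, pow_succ, ← mul_assoc, neg_I_pow_mul, Complex.im_ofReal_mul]
  simp

lemma exists_merminProduct_im_of_even (j : ℕ) :
    ∃ m : Axis → Fin (2 * j + 1 + 1) → ℤˣ, (∀ k, m .Y k = 1) ∧
      (merminProduct m).im = 2 ^ (j + 1) := by
  obtain ⟨m, hY, hm⟩ := exists_merminProduct_eq j (2 * j + 1)
  refine ⟨m, hY, ?_⟩
  rw [hm, show 2 * j + 1 + 1 = 2 * j + 2 by rfl, pow_add, ← mul_assoc, neg_I_pow_mul,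
    Complex.im_ofReal_mul, pow_two]
  simp
  ring

lemma four_mul_indepNum {n : ℕ} [Nonempty (Fin n)] {b : ℝ}
    (hle : ∀ m : Axis → Fin n → ℤˣ, (merminProduct m).im ≤ b)
    (hex : ∃ m : Axis → Fin n → ℤˣ, (∀ k, m .Y k = 1) ∧ (merminProduct m).im = b) :
    (4 * (exclusivityGraph (⊤ : SimpleGraph (Fin n))).indepNum : ℝ) =
      3 * 2 ^ n - 4 + 2 * b := by
  apply le_antisymm
  · obtain ⟨m, hm⟩ := exists_indepNum_le_card_consistentSets (V := Fin n)
    have h := four_mul_card_consistentSets_le m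
    rw [Fintype.card_fin] at h
    have hm' : ((exclusivityGraph (⊤ : SimpleGraph (Fin n))).indepNum : ℝ) ≤
      #(consistentSets m) := by exact_mod_cast hm
    linarith [hle m]
  · obtain ⟨m, hY, hm⟩ := hex
    have h := four_mul_card_consistentSets_eq hY
    rw [Fintype.card_fin, hm] at h
    have hm' : (#(consistentSets m) : ℝ) ≤
      (exclusivityGraph (⊤ : SimpleGraph (Fin n))).indepNum := by
      exact_mod_cast card_consistentSets_le_indepNum m
    linarith

end Mermin

end GraphState

theorem mainTheorem6 (n : ℕ) (hn : 1 ≤ n) :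
    (Odd n →
      ((GraphState.exclusivityGraph (⊤ : SimpleGraph (Fin n))).indepNum : ℝ) =
        (2 : ℝ) ^ (((n : ℝ) - 3) / 2) + 3 * (2 : ℝ) ^ ((n : ℝ) - 2) - 1) ∧
    (Even n →
      ((GraphState.exclusivityGraph (⊤ : SimpleGraph (Fin n))).indepNum : ℝ) =
        (2 : ℝ) ^ ((n : ℝ) / 2 - 1) - (2 : ℝ) ^ ((n : ℝ) - 2) + (2 : ℝ) ^ n - 1) := by
  have hn2 : (2 : ℝ) ^ ((n : ℝ) - 2) = 2 ^ n / 4 := by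
    rw [Real.rpow_sub two_pos, Real.rpow_natCast]
    norm_num
  constructor
  · rintro ⟨j, rfl⟩
    have h := GraphState.four_mul_indepNum
      (fun m => GraphState.merminProduct_im_le_of_odd m (Fintype.card_fin _))
      (GraphState.exists_merminProduct_im_of_odd j)
    have hj : (2 : ℝ) ^ ((((2 * j + 1 : ℕ) : ℝ) - 3) / 2) = 2 ^ j / 2 := by
      rw [show (((2 * j + 1 : ℕ) : ℝ) - 3) / 2 = (j : ℝ) - 1 by push_cast; ring,
        Real.rpow_sub two_pos, Real.rpow_natCast, Real.rpow_one]
    rw [hn2, hj]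
    linarith
  · rintro ⟨i, hi⟩
    -- Writing `n = 2j + 2` keeps two factors `1 + i` aside, with `Im = 2` after the other `2j` are
    -- rotated to `2 ^ j`.
    obtain ⟨j, rfl⟩ : ∃ j, n = 2 * j + 1 + 1 := ⟨i - 1, by lia⟩
    have h := GraphState.four_mul_indepNum
      (fun m => GraphState.merminProduct_im_le_of_even m (j := j + 1) (by simp; ring))
      (GraphState.exists_merminProduct_im_of_even j)
    have hj : (2 : ℝ) ^ (((2 * j + 1 + 1 : ℕ) : ℝ) / 2 - 1) = 2 ^ j := by
      rw [show ((2 * j + 1 + 1 : ℕ) : ℝ) / 2 - 1 = (j : ℝ) by push_cast; ring, Real.rpow_natCast]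
    rw [hn2, hj]
    rw [pow_succ (2 : ℝ) j] at h
    linarith
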